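/- Let $p$ be a prime, $g\ge 1$, $q=p^g$, and $G=GL_2(\mathbb F_q)$. Let $K_0(G)$ be the Grothendieck ring of finitely generated $\mathbb F_q[G]$-modules: the abelian group generated by the isomorphism classes $[A]$, with the relations $[B]=[A]+[C]$ for all short exact sequences $0\to A\to B\to C\to 0$, and with the product induced by $\otimes_{\mathbb F_q}$. Let $e=[\det]\in K_0(G)^\times$ be the class of the determinant character. For $k\ge 0$ let $M_k$ denote the class of $\mathrm{Sym}^k\,\mathbb F_q^2$, the space of homogeneous polynomials of degree $k$ in $\mathbb F_q[X,Y]$ on which $\begin{pmatrix} a&b\\ c&d\end{pmatrix}\in G$ acts by the substitution $X\mapsto aX+cY$, $Y\mapsto bX+dY$. Put $M_{-1}=0$, and $M_k=-e^{1+k}M_{-k-2}$ for $k\le -2$. Let $M_1^{[1]}$ be the class of the Frobenius twist of $\mathrm{Sym}^1\,\mathbb F_q^2$, on which a matrix acts through the matrix obtained by raising each of its entries to the $p$-th power. Then for every $k\in\mathbb Z$ the following identity holds in $K_0(G)$: $$M_k=M_{k-p}\,M_1^{[1]}-e^{p}M_{k-2p}.$$ -/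

import Mathlib

namespace ModRep

open CategoryTheory MonoidalCategory

universe u v

section GrothendieckRing

variable (F : Type u) [Field F] (G : Type v) [Group G]

/-- The ring whose additive group is the free abelian group on the isomorphism classes of
finite-dimensional representations of `G` over `F`, the product being induced by tensor product
over `F`. -/
abbrev FreeRing : Type _ := MonoidAlgebra ℤ (Skeleton (FDRep F G))

variable {F G}

/-- The basis element of the free abelian group attached to the isomorphism class of `A`. -/
noncomputable def freeCls (A : FDRep F G) : FreeRing F G :=
  MonoidAlgebra.of ℤ (Skeleton (FDRep F G)) (toSkeleton A)

variable (F G)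

/-- The elements `[B] - [A] - [C]` for all short exact sequences `0 → A → B → C → 0` of
finite-dimensional representations. -/
def exactRelations : Set (FreeRing F G) :=
  {x | ∃ (A B C : FDRep F G) (i : Representation.IntertwiningMap A.ρ B.ρ)
      (j : Representation.IntertwiningMap B.ρ C.ρ),
    Function.Injective i ∧ Function.Exact i j ∧ Function.Surjective j ∧
      x = freeCls B - freeCls A - freeCls C}

variable {F G}

lemma freeCls_mul (A B : FDRep F G) : freeCls A * freeCls B = freeCls (A ⊗ B) := by
  simp only [freeCls, Skeleton.toSkeleton_tensorObj, map_mul]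

lemma freeCls_mul_mem {x : FreeRing F G} (hx : x ∈ exactRelations F G) (D : FDRep F G) :
    freeCls D * x ∈ exactRelations F G := by
  obtain ⟨A, B, C, i, j, hi, hij, hj, rfl⟩ := hx
  refine ⟨D ⊗ A, D ⊗ B, D ⊗ C,
    ⟨i.toLinearMap.lTensor D, fun g => ?_⟩, ⟨j.toLinearMap.lTensor D, fun g => ?_⟩,
    Module.Flat.lTensor_preserves_injective_linearMap (M := D) i.toLinearMap hi,
    lTensor_exact D hij hj, LinearMap.lTensor_surjective D hj, ?_⟩
  · refine TensorProduct.ext' fun d a => ?_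
    change D.ρ g d ⊗ₜ[F] i (A.ρ g a) = D.ρ g d ⊗ₜ[F] B.ρ g (i a)
    rw [i.isIntertwining]
  · refine TensorProduct.ext' fun d a => ?_
    change D.ρ g d ⊗ₜ[F] j (B.ρ g a) = D.ρ g d ⊗ₜ[F] C.ρ g (j a)
    rw [j.isIntertwining]
  · simp only [mul_sub, freeCls_mul]

variable (F G)

/-- The additive subgroup generated by the relations `[B] = [A] + [C]`; it is an ideal, because
tensor products over a field are exact. -/
noncomputable def relIdeal : Ideal (FreeRing F G) where
  __ := AddSubgroup.closure (exactRelations F G)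
  smul_mem' := by
    intro c x hx
    change c * x ∈ AddSubgroup.closure (exactRelations F G)
    change x ∈ AddSubgroup.closure (exactRelations F G) at hx
    induction c using MonoidAlgebra.induction_on with
    | of s =>
      induction hx using AddSubgroup.closure_induction with
      | mem y hy =>
        have hs : MonoidAlgebra.of ℤ (Skeleton (FDRep F G)) s =
            freeCls (Quotient.out s) :=
          congrArg (MonoidAlgebra.of ℤ (Skeleton (FDRep F G))) (Quotient.out_eq s).symm
        rw [hs]
        exact AddSubgroup.subset_closure (freeCls_mul_mem hy _)
      | zero => simp
      | add y z _ _ hy hz => rw [mul_add]; exact add_mem hy hz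
      | neg y _ hy => rw [mul_neg]; exact neg_mem hy
    | add a b ha hb => rw [add_mul]; exact add_mem ha hb
    | smul n a ha => rw [smul_mul_assoc]; exact zsmul_mem ha n

/-- The Grothendieck ring `K₀(G)` of finite-dimensional representations of `G` over `F`. -/
abbrev K0 : Type _ := FreeRing F G ⧸ relIdeal F G

variable {F G}

/-- The class `[A]` in `K₀(G)`. -/
noncomputable def cls (A : FDRep F G) : K0 F G := Ideal.Quotient.mk (relIdeal F G) (freeCls A)

lemma cls_congr {A B : FDRep F G} (h : Nonempty (A ≅ B)) : cls A = cls B := by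
  have h' : toSkeleton A = toSkeleton B := Quotient.sound h
  rw [cls, cls, freeCls, freeCls, h']

/-- The one-dimensional representation of `G` on `F` attached to a character `χ : G → Fˣ`. -/
noncomputable def charRep (χ : G →* Fˣ) : Representation F G F :=
  (algebraMap F (Module.End F F)).toMonoidHom.comp ((Units.coeHom F).comp χ)

lemma charRep_apply (χ : G →* Fˣ) (g : G) (x : F) : charRep χ g x = (χ g : F) * x := rfl

lemma cls_charRep_mul (χ ψ : G →* Fˣ) :
    cls (FDRep.of (charRep χ)) * cls (FDRep.of (charRep ψ)) = cls (FDRep.of (charRep (χ * ψ))) := by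
  have h : cls (FDRep.of (charRep χ)) * cls (FDRep.of (charRep ψ)) =
      cls (FDRep.of (charRep χ) ⊗ FDRep.of (charRep ψ)) := by
    simp only [cls, ← map_mul, freeCls_mul]
  rw [h]
  refine cls_congr ⟨Action.mkIso (LinearEquiv.toFGModuleCatIso (TensorProduct.lid F F)) fun g => ?_⟩
  ext : 1
  refine TensorProduct.ext' fun a b => ?_
  change (charRep χ g a) * (charRep ψ g b) = charRep (χ * ψ) g (a * b)
  simp only [charRep_apply, MonoidHom.mul_apply, Units.val_mul]
  ring

lemma cls_charRep_one : cls (FDRep.of (charRep (1 : G →* Fˣ))) = 1 := by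
  have h : cls (𝟙_ (FDRep F G)) = 1 := by
    rw [cls, freeCls, ← Skeleton.one_eq, map_one, map_one]
  rw [← h]
  refine cls_congr ⟨Action.mkIso (Iso.refl _) fun g => ?_⟩
  ext : 1
  refine LinearMap.ext fun a => ?_
  change charRep (1 : G →* Fˣ) g a = a
  simp [charRep_apply]

lemma cls_charRep_mul_inv (χ : G →* Fˣ) :
    cls (FDRep.of (charRep χ)) * cls (FDRep.of (charRep χ⁻¹)) = 1 := by
  have h : χ * χ⁻¹ = 1 := MonoidHom.ext fun g => by
    simp only [MonoidHom.mul_apply, MonoidHom.inv_apply, mul_inv_cancel, MonoidHom.one_apply]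
  rw [cls_charRep_mul, h, cls_charRep_one]

end GrothendieckRing

section GL2

variable (F : Type u) [Field F]

/-- The group `GL₂(F)`. -/
abbrev GL2 : Type u := Matrix.GeneralLinearGroup (Fin 2) F

/-- The class `e = [det]`, a unit of `K₀(GL₂(F))` with inverse `[det⁻¹]`. -/
noncomputable def detUnit : (K0 F (GL2 F))ˣ where
  val := cls (FDRep.of (charRep Matrix.GeneralLinearGroup.det))
  inv := cls (FDRep.of (charRep Matrix.GeneralLinearGroup.det⁻¹))
  val_inv := cls_charRep_mul_inv _
  inv_val := by rw [mul_comm]; exact cls_charRep_mul_inv _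

variable {F}

/-- The substitution `X ↦ aX + cY`, `Y ↦ bX + dY` of `F[X, Y]` given by the matrix
`(a b; c d)`, with `X = X 0` and `Y = X 1`. -/
noncomputable def subst (g : Matrix (Fin 2) (Fin 2) F) :
    MvPolynomial (Fin 2) F →ₐ[F] MvPolynomial (Fin 2) F :=
  MvPolynomial.aeval fun j => ∑ i, MvPolynomial.C (g i j) * MvPolynomial.X i

lemma subst_one : subst (1 : Matrix (Fin 2) (Fin 2) F) = AlgHom.id F _ := by
  refine MvPolynomial.algHom_ext fun j => ?_
  fin_cases j <;> simp [subst]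

lemma subst_mul (g h : Matrix (Fin 2) (Fin 2) F) : subst (g * h) = (subst g).comp (subst h) := by
  refine MvPolynomial.algHom_ext fun j => ?_
  simp [subst, Matrix.mul_apply, Fin.sum_univ_two, MvPolynomial.algebraMap_eq]
  ring

lemma subst_mem (g : Matrix (Fin 2) (Fin 2) F) {k : ℕ} {f : MvPolynomial (Fin 2) F}
    (hf : f ∈ MvPolynomial.homogeneousSubmodule (Fin 2) F k) :
    subst g f ∈ MvPolynomial.homogeneousSubmodule (Fin 2) F k := by
  rw [MvPolynomial.mem_homogeneousSubmodule] at hf ⊢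
  have h := hf.aeval (n := 1) (fun j => ∑ i, MvPolynomial.C (g i j) * MvPolynomial.X i)
    fun j => MvPolynomial.IsHomogeneous.sum _ _ _ fun i _ => by
      simpa using (MvPolynomial.isHomogeneous_C (Fin 2) (g i j)).mul
        (MvPolynomial.isHomogeneous_X F i)
  simpa [subst] using h

/-- The space of homogeneous polynomials of degree `k` in `F[X, Y]`. -/
abbrev Homog (F : Type u) [Field F] (k : ℕ) : Type u :=
  MvPolynomial.homogeneousSubmodule (Fin 2) F k

instance (k : ℕ) : Module.Finite F (Homog F k) :=
  Module.Finite.iff_fg.mpr (MvPolynomial.homogeneousSubmodule_fg (Fin 2) F k)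

variable (F)

/-- The `k`-th symmetric power `Sym^k F²` of the standard representation of `GL₂(F)`, realised on
the homogeneous polynomials of degree `k` in `F[X, Y]`. -/
noncomputable def symRep (k : ℕ) : Representation F (GL2 F) (Homog F k) where
  toFun g := (subst g.val).toLinearMap.restrict fun _ hf => subst_mem g.val hf
  map_one' := by
    refine LinearMap.ext fun f => Subtype.ext ?_
    change subst (1 : Matrix (Fin 2) (Fin 2) F) f.val = f.val
    rw [subst_one, AlgHom.id_apply]
  map_mul' g h := by
    refine LinearMap.ext fun f => Subtype.ext ?_
    change subst (g.val * h.val) f.val = subst g.val (subst h.val f.val)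
    rw [subst_mul, AlgHom.comp_apply]

/-- The element `M_k` of `K₀(GL₂(F))` for `k ∈ ℤ`: the class of `Sym^k F²` if `k ≥ 0`, zero if
`k = -1`, and `-e^(1+k) M_{-k-2}` if `k ≤ -2`. -/
noncomputable def M (k : ℤ) : K0 F (GL2 F) :=
  if 0 ≤ k then cls (FDRep.of (symRep F k.toNat))
  else if k = -1 then 0
  else -((detUnit F ^ (1 + k) : (K0 F (GL2 F))ˣ) : K0 F (GL2 F)) *
    cls (FDRep.of (symRep F (-k - 2).toNat))

variable {F}

/-- The `n`-th Frobenius twist of a representation of `GL₂(F)`: the action is composed with the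
map of `GL₂(F)` that applies the `n`-th power of `σ : x ↦ x^p` to each matrix entry. -/
noncomputable def frobTwist [Finite F] (p : ℕ) [Fact p.Prime] [CharP F p] (n : ℤ)
    {V : Type u} [AddCommGroup V] [Module F V] (ρ : Representation F (GL2 F) V) :
    Representation F (GL2 F) V :=
  ρ.comp (Matrix.GeneralLinearGroup.map
    (((frobeniusEquiv F p : RingAut F) ^ n : RingAut F) : F ≃+* F).toRingHom)

end GL2

end ModRep

namespace ModRep

open CategoryTheory MonoidalCategory MvPolynomial
open scoped TensorProduct

universe u v

/-! ### Computing with classes in the Grothendieck ring -/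

section Classes

variable {F : Type u} [Field F] {G : Type v} [Group G]

/-! The Frobenius twist of `Sym^1` is the span of `X^p` and `Y^p`, so multiplication of polynomials
gives an equivariant map `Sym^(k-p) ⊗ (Sym^1)^[1] → Sym^k` whose image is the degree `k` part of the
ideal `(X^p, Y^p)`.

For `k ≥ 2p` it is surjective, and its kernel is the Koszul syzygy module `det^p ⊗ Sym^(k-2p)`
(`cls_symRep_mul_of_le`). For `k = 2p-1` it is an isomorphism (`cls_symRep_mul_of_eq`), which
matches `M_{-1} = 0`.

For `p ≤ k ≤ 2p-2` it is injective but not surjective. Put `n = k-p+1`. The cokernel is `det^n ⊗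
Sym^(2p-2-k)`, and the projection to it is the characteristic `p` analogue of Bol's operator, `f ↦
Y^(-n) ∂ⁿf/∂Xⁿ` (`cls_symRep_mul_of_lt`). This cokernel contributes `-e^p M_{k-2p}`, by the
definition of `M` at negative indices.

The rest is formal: `M_k = -e^(1+k) M_{-k-2}` holds for every `k` (`M_reflect`). It settles `k =
p-1`, and it carries the identity at `2p-2-k` to the identity at `k`. -/

lemma cls_mul (A B : FDRep F G) : cls A * cls B = cls (A ⊗ B) := by
  simp only [cls, ← map_mul, freeCls_mul]

section

variable {A B C : Type u} [AddCommGroup A] [Module F A] [Module.Finite F A]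
  [AddCommGroup B] [Module F B] [Module.Finite F B]
  [AddCommGroup C] [Module F C] [Module.Finite F C]

lemma cls_of_exact {ρA : Representation F G A} {ρB : Representation F G B}
    {ρC : Representation F G C} (i : A →ₗ[F] B) (j : B →ₗ[F] C)
    (hiρ : ∀ g a, i (ρA g a) = ρB g (i a)) (hjρ : ∀ g b, j (ρB g b) = ρC g (j b))
    (hi : Function.Injective i) (hij : Function.Exact i j) (hj : Function.Surjective j) :
    cls (FDRep.of ρB) = cls (FDRep.of ρA) + cls (FDRep.of ρC) := by
  have h : freeCls (FDRep.of ρB) - freeCls (FDRep.of ρA) - freeCls (FDRep.of ρC) ∈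
      relIdeal F G :=
    AddSubgroup.subset_closure ⟨FDRep.of ρA, FDRep.of ρB, FDRep.of ρC,
      ⟨i, fun g => LinearMap.ext (hiρ g)⟩, ⟨j, fun g => LinearMap.ext (hjρ g)⟩, hi, hij, hj, rfl⟩
  have h' := Ideal.Quotient.eq_zero_iff_mem.mpr h
  rw [map_sub, map_sub, sub_sub, sub_eq_zero] at h'
  exact h'

lemma cls_of_equiv {ρA : Representation F G A} {ρB : Representation F G B} (i : A ≃ₗ[F] B)
    (hiρ : ∀ g a, i (ρA g a) = ρB g (i a)) : cls (FDRep.of ρA) = cls (FDRep.of ρB) := by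
  refine cls_congr ⟨Action.mkIso (LinearEquiv.toFGModuleCatIso i) fun g => ?_⟩
  ext : 1
  exact LinearMap.ext (hiρ g)

lemma cls_of_bijective {ρA : Representation F G A} {ρB : Representation F G B} (i : A →ₗ[F] B)
    (hiρ : ∀ g a, i (ρA g a) = ρB g (i a)) (hi : Function.Bijective i) :
    cls (FDRep.of ρA) = cls (FDRep.of ρB) :=
  cls_of_equiv (LinearEquiv.ofBijective i hi) hiρ

lemma cls_tprod (ρA : Representation F G A) (ρB : Representation F G B) :
    cls (FDRep.of (ρA.tprod ρB)) = cls (FDRep.of ρA) * cls (FDRep.of ρB) := by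
  rw [cls_mul]
  refine cls_congr ⟨Action.mkIso (Iso.refl _) fun g => ?_⟩
  ext : 1
  exact LinearMap.ext fun _ => rfl

/-- The twist of a representation by a character. -/
noncomputable def charTwist (χ : G →* Fˣ) (ρ : Representation F G A) : Representation F G A where
  toFun g := (χ g : F) • ρ g
  map_one' := by simp
  map_mul' g h := by
    simp only [map_mul, Units.val_mul, smul_mul_smul_comm]

omit [Module.Finite F A] in
lemma charTwist_apply (χ : G →* Fˣ) (ρ : Representation F G A) (g : G) (a : A) :
    charTwist χ ρ g a = (χ g : F) • ρ g a := rfl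

lemma cls_charTwist (χ : G →* Fˣ) (ρ : Representation F G A) :
    cls (FDRep.of (charTwist χ ρ)) = cls (FDRep.of (charRep χ)) * cls (FDRep.of ρ) := by
  rw [← cls_tprod]
  refine (cls_of_equiv (TensorProduct.lid F A) fun g t => ?_).symm
  induction t using TensorProduct.induction_on with
  | zero => simp
  | tmul c a =>
    simp [charTwist_apply, charRep_apply, smul_smul, mul_comm]
  | add x y hx hy => simp only [map_add, hx, hy]

end

lemma cls_charRep_pow (χ : G →* Fˣ) (n : ℕ) :
    cls (FDRep.of (charRep (χ ^ n))) = cls (FDRep.of (charRep χ)) ^ n := by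
  induction n with
  | zero =>
    rw [show χ ^ 0 = 1 from MonoidHom.ext fun _ => pow_zero _, pow_zero, cls_charRep_one]
  | succ n ih =>
    rw [show χ ^ (n + 1) = χ ^ n * χ from MonoidHom.ext fun _ => pow_succ _ _, pow_succ, ← ih,
      cls_charRep_mul]

end Classes

/-! ### Binary forms: the ideal `(X^n, Y^n)`, directional derivatives and Bol's operator -/

section BinaryForms

variable {F : Type u} [Field F]

lemma isHomogeneous_iff_coeff {f : MvPolynomial (Fin 2) F} {k : ℕ} :
    f.IsHomogeneous k ↔ ∀ s, coeff s f ≠ 0 → s 0 + s 1 = k := by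
  have h (s : Fin 2 →₀ ℕ) : Finsupp.weight (1 : Fin 2 → ℕ) s = s 0 + s 1 := by
    simp [Finsupp.weight_apply, Finsupp.sum_fintype, Fin.sum_univ_two]
  simp only [IsHomogeneous, IsWeightedHomogeneous, h]

lemma IsHomogeneous.divMonomial {f : MvPolynomial (Fin 2) F} {s : Fin 2 →₀ ℕ} {k : ℕ}
    (hf : f.IsHomogeneous (k + (s 0 + s 1))) : (f.divMonomial s).IsHomogeneous k := by
  rw [isHomogeneous_iff_coeff] at hf ⊢
  intro t ht
  rw [coeff_divMonomial] at ht
  have := hf _ ht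
  simp only [Finsupp.add_apply] at this
  omega

lemma X_pow_dvd_of_coeff {f : MvPolynomial (Fin 2) F} {i : Fin 2} {n : ℕ}
    (h : ∀ s, coeff s f ≠ 0 → n ≤ s i) :
    X i ^ n * (f.divMonomial (Finsupp.single i n)) = f := by
  have h0 : f.modMonomial (Finsupp.single i n) = 0 := by
    ext s
    by_cases hs : Finsupp.single i n ≤ s
    · rw [coeff_modMonomial_of_le _ hs, coeff_zero]
    · rw [coeff_modMonomial_of_not_le _ hs, coeff_zero]
      by_contra hc
      exact hs (Finsupp.single_le_iff.mpr (h s hc))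
  have h1 := divMonomial_add_modMonomial f (Finsupp.single i n)
  rw [h0, add_zero, ← X_pow_eq_monomial] at h1
  exact h1

lemma coeff_mul_X_pow_ne_zero {f : MvPolynomial (Fin 2) F} {i : Fin 2} {n : ℕ}
    {s : Fin 2 →₀ ℕ} (h : coeff s (f * X i ^ n) ≠ 0) : n ≤ s i := by
  by_contra hn
  rw [X_pow_eq_monomial, coeff_mul_monomial', if_neg] at h
  · exact h rfl
  · rwa [Finsupp.single_le_iff]

lemma coeff_mul_X_pow_add (f : MvPolynomial (Fin 2) F) (i : Fin 2) (n : ℕ) (s : Fin 2 →₀ ℕ) :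
    coeff (s + Finsupp.single i n) (f * X i ^ n) = coeff s f := by
  rw [X_pow_eq_monomial, coeff_mul_monomial, mul_one]

lemma degree_of_mul_X_pow {f : MvPolynomial (Fin 2) F} {i : Fin 2} {n k : ℕ}
    (hf : (f * X i ^ n).IsHomogeneous k) {s : Fin 2 →₀ ℕ} (hs : coeff s f ≠ 0) :
    s 0 + s 1 + n = k := by
  rw [← coeff_mul_X_pow_add f i n s] at hs
  have := isHomogeneous_iff_coeff.mp hf _ hs
  fin_cases i <;> simp at this <;> omega

/-- The relations between `X ^ n` and `Y ^ n` are the trivial ones. -/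
lemma exists_of_mul_X_pow_add_eq_zero {n : ℕ} {a b : MvPolynomial (Fin 2) F}
    (h : a * X 0 ^ n + b * X 1 ^ n = 0) : ∃ c, a = c * X 1 ^ n ∧ b = -c * X 0 ^ n := by
  have h1 : (X 1 : MvPolynomial (Fin 2) F) ^ n ∣ a * X 0 ^ n :=
    ⟨-b, by linear_combination h⟩
  have h2 : ¬ (X 1 : MvPolynomial (Fin 2) F) ∣ X 0 ^ n := fun hd => by
    have := (X_prime (R := F) (i := (1 : Fin 2))).dvd_of_dvd_pow hd
    rw [X_dvd_X] at this
    exact absurd this (by decide)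
  obtain ⟨c, hc⟩ := X_prime.pow_dvd_of_dvd_mul_right n h2 h1
  refine ⟨c, by rw [hc, mul_comm], ?_⟩
  have h3 : (X 1 : MvPolynomial (Fin 2) F) ^ n ≠ 0 := pow_ne_zero _ (X_ne_zero _)
  refine mul_right_cancel₀ h3 ?_
  rw [hc] at h
  linear_combination h

/-- The forms of degree `k + n` in the ideal `(X ^ n, Y ^ n)`. -/
lemma exists_eq_mul_X_pow_add_iff {k n : ℕ} {f : MvPolynomial (Fin 2) F}
    (hf : f.IsHomogeneous (k + n)) :
    (∃ a b : MvPolynomial (Fin 2) F, a.IsHomogeneous k ∧ b.IsHomogeneous k ∧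
      a * X 0 ^ n + b * X 1 ^ n = f) ↔ ∀ s, coeff s f ≠ 0 → n ≤ s 0 ∨ n ≤ s 1 := by
  constructor
  · rintro ⟨a, b, -, -, rfl⟩ s hs
    by_contra! hc
    refine hs ?_
    rw [coeff_add, not_imp_comm.mp coeff_mul_X_pow_ne_zero hc.1.not_ge,
      not_imp_comm.mp coeff_mul_X_pow_ne_zero hc.2.not_ge, add_zero]
  · intro h
    set a := f.divMonomial (Finsupp.single 0 n) with ha
    set r := f.modMonomial (Finsupp.single 0 n) with hr
    have hak : a.IsHomogeneous k := IsHomogeneous.divMonomial (by simpa using hf)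
    have hcoeff : ∀ s, coeff s r ≠ 0 → coeff s f ≠ 0 ∧ ¬ n ≤ s 0 := fun s hs => by
      by_cases hle : Finsupp.single 0 n ≤ s
      · exact absurd (coeff_modMonomial_of_le _ hle) hs
      · rw [hr, coeff_modMonomial_of_not_le _ hle] at hs
        exact ⟨hs, fun h => hle (Finsupp.single_le_iff.mpr h)⟩
    have hrk : r.IsHomogeneous (k + n) := isHomogeneous_iff_coeff.mpr fun s hs =>
      isHomogeneous_iff_coeff.mp hf s (hcoeff s hs).1
    refine ⟨a, r.divMonomial (Finsupp.single 1 n), hak,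
      IsHomogeneous.divMonomial (by simpa using hrk), ?_⟩
    -- The remainder of `f` modulo `X^n` keeps only monomials with `s 0 < n`, so all of them are
    -- divisible by `Y^n`.
    have h1 := X_pow_dvd_of_coeff (i := 1) (n := n) fun s hs =>
      (h s (hcoeff s hs).1).resolve_left (hcoeff s hs).2
    rw [mul_comm _ (X 1 ^ n), h1, mul_comm, X_pow_eq_monomial]
    exact divMonomial_add_modMonomial f _

/-- The derivative in the direction `w`. -/
noncomputable def dirDeriv (w : Fin 2 → F) :
    Derivation F (MvPolynomial (Fin 2) F) (MvPolynomial (Fin 2) F) :=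
  w 0 • pderiv 0 + w 1 • pderiv 1

lemma dirDeriv_apply (w : Fin 2 → F) (f : MvPolynomial (Fin 2) F) :
    dirDeriv w f = C (w 0) * pderiv 0 f + C (w 1) * pderiv 1 f := by
  simp only [dirDeriv, Derivation.add_apply, Derivation.smul_apply, smul_eq_C_mul]

lemma isHomogeneous_dirDeriv (w : Fin 2 → F) {f : MvPolynomial (Fin 2) F} {k : ℕ}
    (hf : f.IsHomogeneous (k + 1)) : (dirDeriv w f).IsHomogeneous k := by
  rw [dirDeriv_apply]
  refine IsHomogeneous.add ?_ ?_
  · simpa using (isHomogeneous_C (Fin 2) (w 0)).mul (hf.pderiv (i := 0))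
  · simpa using (isHomogeneous_C (Fin 2) (w 1)).mul (hf.pderiv (i := 1))

lemma isHomogeneous_iterate_dirDeriv (w : Fin 2 → F) {k : ℕ} (n : ℕ)
    {f : MvPolynomial (Fin 2) F} (hf : f.IsHomogeneous (k + n)) :
    ((dirDeriv w)^[n] f).IsHomogeneous k := by
  induction n generalizing f with
  | zero => exact hf
  | succ n ih => exact ih (isHomogeneous_dirDeriv w hf)

lemma pderiv_comm (i j : Fin 2) (f : MvPolynomial (Fin 2) F) :
    pderiv i (pderiv j f) = pderiv j (pderiv i f) := by
  ext s
  simp only [coeff_pderiv]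
  by_cases h : i = j
  · rw [h]
  · simp [h, Ne.symm h, add_right_comm s]
    ring

lemma dirDeriv_pderiv_comm (w : Fin 2 → F) :
    Function.Commute (dirDeriv w) (pderiv (R := F) (0 : Fin 2)) := fun f => by
  simp only [dirDeriv_apply, map_add, pderiv_C_mul, pderiv_comm 1 0]

/-- For a form whose degree is `n - 1` in `F`, the `n`-th directional derivatives are all
determined by one of them. -/
lemma X_pow_mul_iterate_dirDeriv (w : Fin 2 → F) {e : ℕ} (he : ((e + 1 : ℕ) : F) = 0) (n : ℕ)
    {f : MvPolynomial (Fin 2) F} (hf : f.IsHomogeneous (e + n)) :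
    X 1 ^ n * (dirDeriv w)^[n] f =
      (C (w 0) * X 1 - C (w 1) * X 0) ^ n * (pderiv 0)^[n] f := by
  induction n generalizing f with
  | zero => simp
  | succ n ih =>
    have h0 : (pderiv 0 f).IsHomogeneous (e + n) := hf.pderiv
    have h1 : ((dirDeriv w)^[n] f).IsHomogeneous (e + 1) :=
      isHomogeneous_iterate_dirDeriv w n (by rwa [add_right_comm])
    -- Euler's identity in degree `e + 1 = 0` of `F`: `X ∂_X + Y ∂_Y` kills the form, so `Y ∂_Y` can
    -- be replaced by `-X ∂_X`.
    have h2 := h1.sum_X_mul_pderiv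
    rw [Fin.sum_univ_two, ← Nat.cast_smul_eq_nsmul F, he, zero_smul] at h2
    have h3 : X 1 * dirDeriv w ((dirDeriv w)^[n] f) =
        (C (w 0) * X 1 - C (w 1) * X 0) * pderiv 0 ((dirDeriv w)^[n] f) := by
      rw [dirDeriv_apply w ((dirDeriv w)^[n] f)]
      linear_combination C (w 1) * h2
    rw [Function.iterate_succ_apply', Function.iterate_succ_apply (pderiv 0), pow_succ, mul_assoc,
      h3, ← (dirDeriv_pderiv_comm w).iterate_left n f, mul_left_comm, ih h0]
    ring

/-- Chain rule: the coefficients of `X` in the images of `X` and `Y` form the first row of `g`. -/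
lemma pderiv_subst (g : Matrix (Fin 2) (Fin 2) F) (f : MvPolynomial (Fin 2) F) :
    pderiv 0 (subst g f) = subst g (dirDeriv (g 0) f) := by
  induction f using MvPolynomial.induction_on with
  | C a => simp [subst]
  | add f h hf hh => simp only [map_add, hf, hh]
  | mul_X f j hf =>
    have hX : pderiv 0 (subst g (X j)) = C (g 0 j) := by
      simp [subst, Fin.sum_univ_two, pderiv_X]
    have hD : dirDeriv (g 0) (X j) = C (g 0 j) := by
      fin_cases j <;> simp [dirDeriv_apply, pderiv_X]
    have hC : subst g (C (g 0 j)) = C (g 0 j) := by simp [subst]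
    simp only [map_mul, Derivation.leibniz, smul_eq_mul, map_add, hX, hD, hf, hC]

lemma iterate_pderiv_subst (g : Matrix (Fin 2) (Fin 2) F) (n : ℕ) (f : MvPolynomial (Fin 2) F) :
    (pderiv 0)^[n] (subst g f) = subst g ((dirDeriv (g 0))^[n] f) := by
  induction n generalizing f with
  | zero => rfl
  | succ n ih => rw [Function.iterate_succ_apply, pderiv_subst, ih, Function.iterate_succ_apply]

lemma coeff_iterate_pderiv (n : ℕ) (f : MvPolynomial (Fin 2) F) (s : Fin 2 →₀ ℕ) :
    coeff s ((pderiv 0)^[n] f) =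
      coeff (s + Finsupp.single 0 n) f * ((s 0 + 1).ascFactorial n : ℕ) := by
  induction n generalizing f with
  | zero => simp
  | succ n ih =>
    rw [Function.iterate_succ_apply, ih, coeff_pderiv, add_assoc, ← Finsupp.single_add,
      Nat.ascFactorial_succ]
    simp
    ring

variable (F) in
/-- The operator `f ↦ (∂ⁿf/∂Xⁿ) / Yⁿ`. -/
noncomputable def bol (n : ℕ) : MvPolynomial (Fin 2) F →ₗ[F] MvPolynomial (Fin 2) F where
  toFun f := (((pderiv (0 : Fin 2)).toLinearMap ^ n) f).divMonomial (Finsupp.single 1 n)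
  map_add' f h := by rw [map_add, add_divMonomial]
  map_smul' c f := by
    ext s
    simp only [map_smul, coeff_divMonomial, coeff_smul, RingHom.id_apply]

lemma bol_apply (n : ℕ) (f : MvPolynomial (Fin 2) F) :
    bol F n f = ((pderiv 0)^[n] f).divMonomial (Finsupp.single 1 n) := by
  change (((pderiv (0 : Fin 2)).toLinearMap ^ n) f).divMonomial (Finsupp.single 1 n) = _
  rw [Module.End.pow_apply]
  rfl

lemma coeff_bol (n : ℕ) (f : MvPolynomial (Fin 2) F) (s : Fin 2 →₀ ℕ) :
    coeff s (bol F n f) =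
      coeff (s + (Finsupp.single 0 n + Finsupp.single 1 n)) f *
        ((s 0 + 1).ascFactorial n : ℕ) := by
  rw [bol_apply, coeff_divMonomial, coeff_iterate_pderiv, add_left_comm, add_comm (Finsupp.single 1 n)]
  simp [add_comm, add_left_comm]

lemma isHomogeneous_bol {n k : ℕ} {f : MvPolynomial (Fin 2) F}
    (hf : f.IsHomogeneous (k + 2 * n)) : (bol F n f).IsHomogeneous k := by
  rw [isHomogeneous_iff_coeff] at hf ⊢
  intro s hs
  rw [coeff_bol] at hs
  have := hf _ (left_ne_zero_of_mul hs)
  simp at this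
  omega

/-! ### Bol's operator in characteristic `p`: equivariance, kernel and image -/

section CharP

variable {p : ℕ} [hp : Fact p.Prime] [CharP F p]

lemma ascFactorial_cast_ne_zero {a n : ℕ} (h : a + n < p) :
    (((a + 1).ascFactorial n : ℕ) : F) ≠ 0 := by
  rw [Ne, CharP.cast_eq_zero_iff F p]
  intro hd
  have := Dvd.dvd.mul_left hd a.factorial
  rw [Nat.factorial_mul_ascFactorial, hp.out.dvd_factorial] at this
  omega

/-- The prime `p` is one of the factors `a + 1, ..., a + n`; equivalently, it divides `(a + n)!` but
not `a!`. -/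
lemma ascFactorial_cast_eq_zero {a n : ℕ} (ha : a < p) (h : p ≤ a + n) :
    (((a + 1).ascFactorial n : ℕ) : F) = 0 := by
  rw [CharP.cast_eq_zero_iff F p]
  have := (hp.out.dvd_factorial (n := a + n)).mpr h
  rw [← Nat.factorial_mul_ascFactorial] at this
  refine (hp.out.dvd_mul.mp this).resolve_left ?_
  rw [hp.out.dvd_factorial]
  omega

/-- The division by `Y^n` is exact: a monomial of the derivative with `Y`-exponent below `n` has
`X`-exponent in `[m + 1, p - 1]`, and its rising factorial vanishes mod `p`. -/
lemma X_pow_mul_bol {n m : ℕ} (hn : m + n + 1 = p) {f : MvPolynomial (Fin 2) F}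
    (hf : f.IsHomogeneous (m + 2 * n)) : X 1 ^ n * bol F n f = (pderiv 0)^[n] f := by
  rw [bol_apply]
  refine X_pow_dvd_of_coeff fun s hs => ?_
  rw [coeff_iterate_pderiv] at hs
  have h1 := isHomogeneous_iff_coeff.mp hf _ (left_ne_zero_of_mul hs)
  simp at h1
  by_contra hc
  exact hs (by rw [ascFactorial_cast_eq_zero (p := p) (by omega) (by omega), mul_zero])

lemma subst_injective (g : GL2 F) : Function.Injective (subst g.val) := by
  refine Function.LeftInverse.injective (g := subst (g⁻¹ : GL2 F).val) fun f => ?_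
  rw [← AlgHom.comp_apply, ← subst_mul, ← Units.val_mul, inv_mul_cancel, Units.val_one, subst_one,
    AlgHom.id_apply]

/-- By the chain rule, `∂_X` after the substitution is the derivative along the first row `w` of
`g`. Its iterates are `((w 0 Y - w 1 X) / Y)^n ∂_X^n`, and `g` sends `w 0 Y - w 1 X` to `det g · Y`,
whence the factor `det^n`. -/
lemma bol_subst {n m : ℕ} (hn : m + n + 1 = p) (g : GL2 F) {f : MvPolynomial (Fin 2) F}
    (hf : f.IsHomogeneous (m + 2 * n)) :
    bol F n (subst g.val f) = C (g.val.det ^ n) * subst g.val (bol F n f) := by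
  have hY : subst g.val (X 1) ≠ 0 := by
    rw [Ne, map_eq_zero_iff _ (subst_injective g)]
    exact X_ne_zero _
  have h1 : (X 1 : MvPolynomial (Fin 2) F) ≠ 0 := X_ne_zero _
  have hlin : subst g.val (C (g.val 0 0) * X 1 - C (g.val 0 1) * X 0) =
      C g.val.det * X 1 := by
    simp [subst, Fin.sum_univ_two, Matrix.det_fin_two]
    ring
  have h2 := congrArg (subst g.val) (X_pow_mul_iterate_dirDeriv (g.val 0) (e := m + n)
    (by rw [hn, CharP.cast_eq_zero]) n (f := f) (by convert hf using 1; ring))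
  rw [map_mul, map_mul, map_pow, map_pow, hlin, ← iterate_pderiv_subst,
    ← X_pow_mul_bol hn hf, ← X_pow_mul_bol hn (subst_mem g.val hf), map_mul, map_pow] at h2
  refine mul_left_cancel₀ (pow_ne_zero n h1) (mul_left_cancel₀ (pow_ne_zero n hY) ?_)
  rw [h2, C_pow]
  ring

lemma bol_eq_zero_iff {n m : ℕ} (hn : m + n + 1 = p) {f : MvPolynomial (Fin 2) F}
    (hf : f.IsHomogeneous (m + 2 * n)) :
    bol F n f = 0 ↔ ∀ s, coeff s f ≠ 0 → p ≤ s 0 ∨ p ≤ s 1 := by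
  constructor
  · intro h s hs
    by_contra! hc
    have hdeg := isHomogeneous_iff_coeff.mp hf s hs
    -- The exponents sum to `p - 1 + n`, so if both are below `p` then both are at least `n`.
    have hle : Finsupp.single 0 n + Finsupp.single 1 n ≤ s := fun i => by
      fin_cases i <;> simp <;> omega
    obtain ⟨t, rfl⟩ := exists_add_of_le hle
    have h0 := congrArg (coeff t) h
    rw [coeff_bol, coeff_zero, add_comm t] at h0
    simp at hc
    refine (mul_ne_zero hs (ascFactorial_cast_ne_zero (p := p) (by omega))) h0
  · intro h
    ext s
    rw [coeff_zero]
    by_contra hc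
    have hs := isHomogeneous_iff_coeff.mp (isHomogeneous_bol hf) s hc
    rw [coeff_bol] at hc
    have := h _ (left_ne_zero_of_mul hc)
    simp at this
    omega

/-- The operator is diagonal on monomials, and in target degree `m` its scalars are products of
integers in `[1, p - 1]`, hence invertible. -/
lemma exists_bol_eq {n m : ℕ} (hn : m + n + 1 = p) {h : MvPolynomial (Fin 2) F}
    (hh : h.IsHomogeneous m) : ∃ f, f.IsHomogeneous (m + 2 * n) ∧ bol F n f = h := by
  refine ⟨∑ s ∈ h.support, monomial (s + (Finsupp.single 0 n + Finsupp.single 1 n))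
    (coeff s h * (((s 0 + 1).ascFactorial n : ℕ) : F)⁻¹), ?_, ?_⟩
  · refine IsHomogeneous.sum _ _ _ fun s hs => isHomogeneous_monomial _ ?_
    have := isHomogeneous_iff_coeff.mp hh s (mem_support_iff.mp hs)
    simp [Finsupp.degree_eq_sum]
    omega
  · rw [map_sum]
    conv_rhs => rw [h.as_sum]
    refine Finset.sum_congr rfl fun s hs => ?_
    have hdeg := isHomogeneous_iff_coeff.mp hh s (mem_support_iff.mp hs)
    ext t
    rw [coeff_bol, coeff_monomial, coeff_monomial]
    by_cases hst : s = t
    · subst hst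
      rw [if_pos rfl, if_pos rfl, inv_mul_cancel_right₀]
      exact ascFactorial_cast_ne_zero (p := p) (by omega)
    · rw [if_neg hst, if_neg (by simpa using hst), zero_mul]

/-- Since `(u + v)^p = u^p + v^p`, the forms `X^p` and `Y^p` transform through the Frobenius of `g`;
this realises the twist inside polynomials. -/
lemma subst_expand (g : Matrix (Fin 2) (Fin 2) F) (f : MvPolynomial (Fin 2) F) :
    subst g (expand p f) = expand p (subst (g.map (frobenius F p)) f) := by
  have h : (subst g).comp (expand p) =
      (expand p).comp (subst (g.map (frobenius F p))) := by
    refine algHom_ext fun j => ?_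
    simp [subst, Fin.sum_univ_two, add_pow_char, mul_pow, frobenius_def]
  exact DFunLike.congr_fun h f

end CharP

end BinaryForms

/-! ### The exact sequences between symmetric powers -/

section Sequences

variable {F : Type u} [Field F]

lemma coe_symRep (k : ℕ) (g : GL2 F) (f : Homog F k) :
    (symRep F k g f : MvPolynomial (Fin 2) F) = subst g.val f.val := rfl

variable (F) in
/-- The linear forms `X` and `Y`. -/
noncomputable def linX (i : Fin 2) : Homog F 1 := ⟨X i, isHomogeneous_X F i⟩

lemma coeff_linX (i j : Fin 2) :
    coeff (Finsupp.single j 1) (linX F i).val = if i = j then 1 else 0 := by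
  simp [linX, coeff_X, Finsupp.single_left_inj]

lemma eq_smul_linX (l : Homog F 1) :
    l = coeff (Finsupp.single 0 1) l.val • linX F 0 + coeff (Finsupp.single 1 1) l.val • linX F 1 := by
  have key : ∀ s : Fin 2 →₀ ℕ, s 0 + s 1 = 1 →
      s = Finsupp.single 0 1 ∨ s = Finsupp.single 1 1 := fun s hs => by
    rcases Nat.eq_zero_or_pos (s 0) with h | h
    · right; ext i; fin_cases i <;> simp <;> omega
    · left; ext i; fin_cases i <;> simp <;> omega
  refine Subtype.ext (MvPolynomial.ext _ _ fun s => ?_)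
  simp only [Submodule.coe_add, Submodule.coe_smul, coeff_add, coeff_smul, smul_eq_mul]
  by_cases hs : s 0 + s 1 = 1
  · rcases key s hs with rfl | rfl <;> simp [coeff_linX]
  · have h (l : Homog F 1) : coeff s l.val = 0 := by
      by_contra hc
      exact hs (isHomogeneous_iff_coeff.mp l.2 s hc)
    simp only [h, mul_zero, add_zero]

lemma exists_tmul_linX {A : Type u} [AddCommGroup A] [Module F A] (t : A ⊗[F] Homog F 1) :
    ∃ a b : A, t = a ⊗ₜ linX F 0 + b ⊗ₜ linX F 1 := by
  induction t using TensorProduct.induction_on with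
  | zero => exact ⟨0, 0, by simp⟩
  | tmul a l =>
    refine ⟨coeff (Finsupp.single 0 1) l.val • a, coeff (Finsupp.single 1 1) l.val • a, ?_⟩
    conv_lhs => rw [eq_smul_linX l]
    simp only [TensorProduct.tmul_add, TensorProduct.tmul_smul, TensorProduct.smul_tmul']
  | add x y hx hy =>
    obtain ⟨a, b, rfl⟩ := hx
    obtain ⟨c, d, rfl⟩ := hy
    exact ⟨a + c, b + d, by simp only [TensorProduct.add_tmul]; abel⟩

lemma left_eq_of_tmul_linX {A : Type u} [AddCommGroup A] [Module F A] {a b c d : A}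
    (h : a ⊗ₜ[F] linX F 0 + b ⊗ₜ[F] linX F 1 = c ⊗ₜ linX F 0 + d ⊗ₜ linX F 1) : a = c := by
  have h' := congrArg ((TensorProduct.rid F A).toLinearMap ∘ₗ
    ((lcoeff F (Finsupp.single (0 : Fin 2) 1)).domRestrict _).lTensor A) h
  simpa [LinearMap.domRestrict_apply, lcoeff_apply, coeff_linX] using h'

variable (F) in
/-- Multiplication of forms by `X i ^ n`. -/
noncomputable def mulXPow (k n : ℕ) (i : Fin 2) : Homog F k →ₗ[F] Homog F (k + n) :=
  (LinearMap.mulRight F (X i ^ n : MvPolynomial (Fin 2) F)).restrict fun _ hf =>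
    IsHomogeneous.mul hf (isHomogeneous_X_pow i n)

lemma coe_mulXPow (k n : ℕ) (i : Fin 2) (f : Homog F k) :
    (mulXPow F k n i f).val = f.val * X i ^ n := rfl

variable {p : ℕ} [hp : Fact p.Prime] [CharP F p]

variable (F p) in
/-- The map `Sym^k ⊗ (Sym^1)^[1] → Sym^(k+p)` given by the multiplication of polynomials, where
`(Sym^1)^[1]` is identified with the span of `X ^ p` and `Y ^ p`. -/
noncomputable def mulExpand (k : ℕ) : Homog F k ⊗[F] Homog F 1 →ₗ[F] Homog F (k + p) :=
  TensorProduct.lift <| LinearMap.mk₂ F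
    (fun f l => ⟨f.val * expand p l.val, IsHomogeneous.mul f.2 <| by
      have h := IsHomogeneous.aeval (n := p) l.2 (fun i => (X i : MvPolynomial (Fin 2) F) ^ p)
        fun i => isHomogeneous_X_pow i p
      rwa [mul_one] at h⟩)
    (fun f f' l => Subtype.ext (add_mul _ _ _))
    (fun c f l => Subtype.ext (smul_mul_assoc _ _ _))
    (fun f l l' => Subtype.ext <| by
      change f.val * expand p (l.val + l'.val) = f.val * expand p l.val + f.val * expand p l'.val
      rw [map_add, mul_add])
    (fun c f l => Subtype.ext <| by
      change f.val * expand p (c • l.val) = c • (f.val * expand p l.val)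
      rw [map_smul, mul_smul_comm])

omit hp [CharP F p] in
lemma coe_mulExpand_tmul (k : ℕ) (f : Homog F k) (l : Homog F 1) :
    (mulExpand F p k (f ⊗ₜ l)).val = f.val * expand p l.val := rfl

omit hp [CharP F p] in
lemma coe_mulExpand_linX (k : ℕ) (a b : Homog F k) :
    (mulExpand F p k (a ⊗ₜ linX F 0 + b ⊗ₜ linX F 1)).val =
      a.val * X 0 ^ p + b.val * X 1 ^ p := by
  simp [coe_mulExpand_tmul, linX]

omit hp [CharP F p] in
lemma mem_range_mulExpand {k : ℕ} (f : Homog F (k + p)) :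
    f ∈ Set.range (mulExpand F p k) ↔ ∀ s, coeff s f.val ≠ 0 → p ≤ s 0 ∨ p ≤ s 1 := by
  rw [← exists_eq_mul_X_pow_add_iff f.2]
  constructor
  · rintro ⟨t, rfl⟩
    obtain ⟨a, b, rfl⟩ := exists_tmul_linX t
    exact ⟨a.val, b.val, a.2, b.2, (coe_mulExpand_linX k a b).symm⟩
  · rintro ⟨a, b, ha, hb, h⟩
    exact ⟨(⟨a, ha⟩ : Homog F k) ⊗ₜ linX F 0 + (⟨b, hb⟩ : Homog F k) ⊗ₜ linX F 1,
      Subtype.ext ((coe_mulExpand_linX k _ _).trans h)⟩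

omit hp [CharP F p] in
-- Syzygies of `X^p` and `Y^p` are multiples of `(Y^p, -X^p)`, so none but zero has coefficients of
-- degree below `p`.
lemma mulExpand_injective {k : ℕ} (hk : k < p) : Function.Injective (mulExpand F p k) := by
  refine (injective_iff_map_eq_zero _).mpr fun t ht => ?_
  obtain ⟨a, b, rfl⟩ := exists_tmul_linX t
  have h := congrArg Subtype.val ht
  rw [coe_mulExpand_linX] at h
  obtain ⟨c, hac, hbc⟩ := exists_of_mul_X_pow_add_eq_zero h
  have hc : c = 0 := by
    ext s
    by_contra hs
    have := degree_of_mul_X_pow (hac ▸ a.2) hs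
    omega
  have ha : a = 0 := Subtype.ext (by rw [hac, hc, zero_mul]; rfl)
  have hb : b = 0 := Subtype.ext (by rw [hbc, hc, neg_zero, zero_mul]; rfl)
  rw [ha, hb, TensorProduct.zero_tmul, TensorProduct.zero_tmul, add_zero]

omit hp [CharP F p] in
-- Pigeonhole: two exponents with sum at least `2p - 1` cannot both be below `p`.
lemma mulExpand_surjective {k : ℕ} (hk : p ≤ k + 1) : Function.Surjective (mulExpand F p k) :=
  fun f => (mem_range_mulExpand f).mpr fun s hs => by
    have := isHomogeneous_iff_coeff.mp f.2 s hs
    omega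

variable (F p) in
/-- The Koszul map `f ↦ f Y ^ p ⊗ X - f X ^ p ⊗ Y`. -/
noncomputable def koszulMap (k : ℕ) : Homog F k →ₗ[F] Homog F (k + p) ⊗[F] Homog F 1 :=
  (TensorProduct.mk F _ _).flip (linX F 0) ∘ₗ mulXPow F k p 1 +
    (TensorProduct.mk F _ _).flip (linX F 1) ∘ₗ ((-1 : F) • mulXPow F k p 0)

omit hp [CharP F p] in
lemma koszulMap_apply (k : ℕ) (f : Homog F k) :
    koszulMap F p k f =
      mulXPow F k p 1 f ⊗ₜ linX F 0 + ((-1 : F) • mulXPow F k p 0 f) ⊗ₜ linX F 1 := rfl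

omit hp [CharP F p] in
lemma koszulMap_injective (k : ℕ) : Function.Injective (koszulMap F p k) := fun f h hfh => by
  rw [koszulMap_apply, koszulMap_apply] at hfh
  have h1 := congrArg Subtype.val (left_eq_of_tmul_linX hfh)
  rw [coe_mulXPow, coe_mulXPow] at h1
  exact Subtype.ext (mul_right_cancel₀ (pow_ne_zero _ (X_ne_zero _)) h1)

omit hp [CharP F p] in
lemma exact_koszulMap (k : ℕ) : Function.Exact (koszulMap F p k) (mulExpand F p (k + p)) := by
  intro t
  constructor
  · intro ht
    obtain ⟨a, b, rfl⟩ := exists_tmul_linX t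
    have h := congrArg Subtype.val ht
    rw [coe_mulExpand_linX] at h
    obtain ⟨c, hac, hbc⟩ := exists_of_mul_X_pow_add_eq_zero h
    have hc : c.IsHomogeneous k := isHomogeneous_iff_coeff.mpr fun s hs => by
      have := degree_of_mul_X_pow (hac ▸ a.2) hs
      omega
    refine ⟨⟨c, hc⟩, ?_⟩
    have ha : mulXPow F k p 1 ⟨c, hc⟩ = a := Subtype.ext hac.symm
    have hb : (-1 : F) • mulXPow F k p 0 ⟨c, hc⟩ = b := Subtype.ext <| by
      change (-1 : F) • (c * X 0 ^ p) = b.val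
      rw [hbc, neg_one_smul, neg_mul]
    rw [koszulMap_apply, ha, hb]
  · rintro ⟨f, rfl⟩
    rw [koszulMap_apply]
    refine Subtype.ext ?_
    rw [coe_mulExpand_linX]
    change f.val * X 1 ^ p * X 0 ^ p + ((-1 : F) • (f.val * X 0 ^ p)) * X 1 ^ p = 0
    rw [neg_one_smul]
    ring

variable [Finite F]

lemma frobTwist_symRep_coe (g : GL2 F) (l : Homog F 1) :
    (frobTwist p 1 (symRep F 1) g l).val = subst (g.val.map (frobenius F p)) l.val := by
  rfl

lemma mulExpand_equivariant (k : ℕ) (g : GL2 F) (t : Homog F k ⊗[F] Homog F 1) :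
    mulExpand F p k ((symRep F k).tprod (frobTwist p 1 (symRep F 1)) g t) =
      symRep F (k + p) g (mulExpand F p k t) := by
  induction t using TensorProduct.induction_on with
  | zero => simp
  | tmul f l =>
    refine Subtype.ext ?_
    rw [coe_symRep, coe_mulExpand_tmul, map_mul, subst_expand]
    rfl
  | add x y hx hy => simp only [map_add, hx, hy]

lemma frobTwist_linX (g : GL2 F) (j : Fin 2) :
    frobTwist p 1 (symRep F 1) g (linX F j) =
      g.val 0 j ^ p • linX F 0 + g.val 1 j ^ p • linX F 1 := by
  refine Subtype.ext ?_
  rw [frobTwist_symRep_coe]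
  simp [linX, subst, Fin.sum_univ_two, frobenius_def, smul_eq_C_mul]

omit [Finite F] in
lemma symRep_mulXPow (k : ℕ) (g : GL2 F) (j : Fin 2) (f : Homog F k) :
    symRep F (k + p) g (mulXPow F k p j f) =
      g.val 0 j ^ p • mulXPow F k p 0 (symRep F k g f) +
        g.val 1 j ^ p • mulXPow F k p 1 (symRep F k g f) := by
  refine Subtype.ext ?_
  simp [coe_symRep, coe_mulXPow, subst, Fin.sum_univ_two, add_pow_char, smul_eq_C_mul]
  ring

/-- The tensor `Y^p ⊗ X - X^p ⊗ Y` is alternating in two copies of the twisted standard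
representation, so `g` scales it by the determinant of its Frobenius, which is `det^p`. -/
lemma koszulMap_equivariant (k : ℕ) (g : GL2 F) (f : Homog F k) :
    koszulMap F p k (charTwist (Matrix.GeneralLinearGroup.det ^ p) (symRep F k) g f) =
      (symRep F (k + p)).tprod (frobTwist p 1 (symRep F 1)) g (koszulMap F p k f) := by
  have hdet : (((Matrix.GeneralLinearGroup.det ^ p : GL2 F →* Fˣ) g : Fˣ) : F) =
      g.val 0 0 ^ p * g.val 1 1 ^ p - g.val 0 1 ^ p * g.val 1 0 ^ p := by
    change g.val.det ^ p = _
    rw [Matrix.det_fin_two, sub_pow_char, mul_pow, mul_pow]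
  rw [charTwist_apply, map_smul, hdet, koszulMap_apply, koszulMap_apply, map_add,
    Representation.tprod_apply, TensorProduct.map_tmul, TensorProduct.map_tmul, map_smul,
    frobTwist_linX, frobTwist_linX, symRep_mulXPow, symRep_mulXPow]
  simp only [TensorProduct.tmul_add, TensorProduct.tmul_smul, ← TensorProduct.smul_tmul',
    TensorProduct.add_tmul, smul_add]
  module

omit [Finite F] in
lemma cls_charTwist_det_pow (n k : ℕ) :
    cls (FDRep.of (charTwist (Matrix.GeneralLinearGroup.det ^ n) (symRep F k))) =
      (detUnit F : K0 F (GL2 F)) ^ n * cls (FDRep.of (symRep F k)) := by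
  rw [cls_charTwist, cls_charRep_pow]
  rfl

variable (F p)

lemma cls_symRep_mul_of_le (k : ℕ) :
    cls (FDRep.of (symRep F (k + p))) * cls (FDRep.of (frobTwist p 1 (symRep F 1))) =
      (detUnit F : K0 F (GL2 F)) ^ p * cls (FDRep.of (symRep F k)) +
        cls (FDRep.of (symRep F (k + p + p))) := by
  rw [← cls_tprod, ← cls_charTwist_det_pow]
  exact cls_of_exact (koszulMap F p k) (mulExpand F p (k + p)) (koszulMap_equivariant k)
    (mulExpand_equivariant (k + p)) (koszulMap_injective k) (exact_koszulMap k)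
    (mulExpand_surjective (by omega))

lemma cls_symRep_mul_of_eq {k : ℕ} (hk : k + 1 = p) :
    cls (FDRep.of (symRep F k)) * cls (FDRep.of (frobTwist p 1 (symRep F 1))) =
      cls (FDRep.of (symRep F (k + p))) := by
  rw [← cls_tprod]
  exact cls_of_bijective (mulExpand F p k) (mulExpand_equivariant k)
    ⟨mulExpand_injective (by omega), mulExpand_surjective (by omega)⟩

lemma cls_symRep_mul_of_lt {k m : ℕ} (hk : m + (k + 1) + 1 = p) :
    cls (FDRep.of (symRep F (k + p))) =
      cls (FDRep.of (symRep F k)) * cls (FDRep.of (frobTwist p 1 (symRep F 1))) +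
        (detUnit F : K0 F (GL2 F)) ^ (k + 1) * cls (FDRep.of (symRep F m)) := by
  -- Bol's operator of order `k + 1` lowers the degree by `2 (k + 1)`, from `k + p` to `m = p - 2 -
  -- k`.
  have hd : k + p = m + 2 * (k + 1) := by omega
  have hhom (f : Homog F (k + p)) : f.val.IsHomogeneous (m + 2 * (k + 1)) := hd ▸ f.2
  rw [← cls_tprod, ← cls_charTwist_det_pow]
  refine cls_of_exact (mulExpand F p k)
    ((bol F (k + 1)).restrict (p := homogeneousSubmodule (Fin 2) F (k + p))
      (q := homogeneousSubmodule (Fin 2) F m) fun f hf =>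
      isHomogeneous_bol (hd ▸ hf)) (mulExpand_equivariant k) (fun g f => Subtype.ext ?_)
    (mulExpand_injective (by omega)) (fun f => ?_) (fun h => ?_)
  · change bol F (k + 1) (subst g.val f.val) = _
    rw [bol_subst hk g (hhom f), ← smul_eq_C_mul]
    rfl
  · rw [mem_range_mulExpand, ← bol_eq_zero_iff hk (hhom f), Subtype.ext_iff]
    rfl
  · obtain ⟨f, hf, hfh⟩ := exists_bol_eq hk h.2
    exact ⟨⟨f, hd ▸ hf⟩, Subtype.ext hfh⟩

end Sequences

/-! ### The recursion for all integers, by reflection -/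

section Recursion

variable (F : Type u) [Field F]

lemma M_natCast (k : ℕ) : M F k = cls (FDRep.of (symRep F k)) := by
  rw [M, if_pos (Int.natCast_nonneg k)]
  rfl

lemma M_neg_one : M F (-1) = 0 := by
  rw [M, if_neg (by decide), if_pos rfl]

lemma M_of_lt_neg_one {k : ℤ} (h : k < -1) :
    M F k = -((detUnit F ^ (1 + k) : (K0 F (GL2 F))ˣ) : K0 F (GL2 F)) * M F (-k - 2) := by
  rw [M, if_neg (by omega), if_neg (by omega), M, if_pos (by omega)]

/-- The rule defining `M` at negative indices is an involution, because the exponents `1 + k` and `1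
+ (-k - 2)` are opposite; hence it holds at every index. -/
lemma M_reflect (k : ℤ) :
    M F k = -((detUnit F ^ (1 + k) : (K0 F (GL2 F))ˣ) : K0 F (GL2 F)) * M F (-k - 2) := by
  rcases lt_trichotomy k (-1) with h | rfl | h
  · exact M_of_lt_neg_one F h
  · rw [show (-(-1) - 2 : ℤ) = -1 by norm_num, M_neg_one, mul_zero]
  · have h1 : ((detUnit F ^ (1 + k) : (K0 F (GL2 F))ˣ) : K0 F (GL2 F)) *
        ((detUnit F ^ (1 + (-k - 2)) : (K0 F (GL2 F))ˣ) : K0 F (GL2 F)) = 1 := by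
      rw [← Units.val_mul, ← zpow_add, show 1 + k + (1 + (-k - 2)) = 0 by ring, zpow_zero,
        Units.val_one]
    have h2 := M_of_lt_neg_one F (k := -k - 2) (by omega)
    rw [show -(-k - 2) - 2 = k by ring] at h2
    rw [h2]
    linear_combination (-M F k) * h1

variable (p : ℕ) [hp : Fact p.Prime] [CharP F p] [Finite F]

lemma M_recursion_of_le {k : ℤ} (hk : p - 1 ≤ k) :
    M F k = M F (k - p) * cls (FDRep.of (frobTwist p 1 (symRep F 1))) -
      (detUnit F : K0 F (GL2 F)) ^ p * M F (k - 2 * p) := by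
  have hp2 := hp.out.two_le
  rcases lt_or_ge k (2 * p) with h | h
  · rcases eq_or_lt_of_le hk with rfl | hk'
    -- At `k = p - 1` the middle term is zero and `M_{-p-1} = -e^(-p) M_{p-1}`, so both sides equal
    -- `M_{p-1}`.
    · rw [show (p - 1 - p : ℤ) = -1 by ring, M_neg_one, M_reflect F (p - 1 - 2 * p),
        show (-(p - 1 - 2 * p) - 2 : ℤ) = p - 1 by ring,
        show (1 + (p - 1 - 2 * p) : ℤ) = -p by ring, zpow_neg, zpow_natCast,
        ← Units.val_pow_eq_pow_val]
      linear_combination (-M F (p - 1)) * Units.mul_inv (detUnit F ^ p)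
    · obtain ⟨n, rfl⟩ : ∃ n : ℕ, k = n + p := ⟨(k - p).toNat, by omega⟩
      rw [show (n + p - p : ℤ) = n by ring, M_natCast, ← Nat.cast_add, M_natCast]
      by_cases hn : n + 1 = p
      · rw [show ((n + p : ℕ) - 2 * p : ℤ) = -1 by omega, M_neg_one, mul_zero, sub_zero,
          cls_symRep_mul_of_eq F p hn]
      · obtain ⟨m, hm⟩ : ∃ m, m + (n + 1) + 1 = p := ⟨p - n - 2, by omega⟩
        -- Reflection gives `M_{n-p} = -e^(n+1-p) M_m`; multiplied by `-e^p` this is the cokernel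
        -- term `e^(n+1) M_m`.
        have h1 : (detUnit F : K0 F (GL2 F)) ^ p *
            ((detUnit F ^ (1 + ((n + p : ℕ) - 2 * p) : ℤ) : (K0 F (GL2 F))ˣ) : K0 F (GL2 F)) =
              (detUnit F : K0 F (GL2 F)) ^ (n + 1) := by
          rw [← Units.val_pow_eq_pow_val, ← Units.val_pow_eq_pow_val, ← Units.val_mul,
            ← zpow_natCast, ← zpow_natCast, ← zpow_add]
          congr 2
          push_cast
          ring
        rw [cls_symRep_mul_of_lt F p hm, M_reflect F ((n + p : ℕ) - 2 * p),
          show (-((n + p : ℕ) - 2 * p) - 2 : ℤ) = m by omega, M_natCast, ← h1]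
        ring
  · obtain ⟨n, rfl⟩ : ∃ n : ℕ, k = n + p + p := ⟨(k - 2 * p).toNat, by omega⟩
    rw [show (n + p + p - p : ℤ) = n + p by ring, show (n + p + p - 2 * p : ℤ) = n by ring,
      ← Nat.cast_add, ← Nat.cast_add, M_natCast, M_natCast, M_natCast, cls_symRep_mul_of_le F p n,
      add_sub_cancel_left]

lemma M_recursion (k : ℤ) :
    M F k = M F (k - p) * cls (FDRep.of (frobTwist p 1 (symRep F 1))) -
      (detUnit F : K0 F (GL2 F)) ^ p * M F (k - 2 * p) := by
  rcases le_or_gt (p - 1 : ℤ) k with h | h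
  · exact M_recursion_of_le F p h
  -- The involution `k ↦ 2p - 2 - k` fixes `p - 1`. After reflecting all three classes, the outer
  -- terms exchange roles and the identity at `k` is a unit multiple of this one.
  · have h1 := M_recursion_of_le F p (k := 2 * p - 2 - k) (by omega)
    rw [show (2 * p - 2 - k - p : ℤ) = p - 2 - k by ring,
      show (2 * p - 2 - k - 2 * p : ℤ) = -k - 2 by ring] at h1
    rw [M_reflect F k, M_reflect F (k - p), M_reflect F (k - 2 * p),
      show (-(k - 2 * p) - 2 : ℤ) = 2 * p - 2 - k by ring,
      show (-(k - p) - 2 : ℤ) = p - 2 - k by ring, h1]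
    have h2 : ((detUnit F ^ (1 + k) : (K0 F (GL2 F))ˣ) : K0 F (GL2 F)) =
        (detUnit F : K0 F (GL2 F)) ^ p * (detUnit F : K0 F (GL2 F)) ^ p *
          ((detUnit F ^ (1 + (k - 2 * p)) : (K0 F (GL2 F))ˣ) : K0 F (GL2 F)) := by
      rw [← Units.val_pow_eq_pow_val, ← Units.val_mul, ← Units.val_mul, ← zpow_natCast,
        ← zpow_add, ← zpow_add]
      congr 2
      ring
    have h3 : ((detUnit F ^ (1 + (k - p)) : (K0 F (GL2 F))ˣ) : K0 F (GL2 F)) =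
        (detUnit F : K0 F (GL2 F)) ^ p *
          ((detUnit F ^ (1 + (k - 2 * p)) : (K0 F (GL2 F))ˣ) : K0 F (GL2 F)) := by
      rw [← Units.val_pow_eq_pow_val, ← Units.val_mul, ← zpow_natCast, ← zpow_add]
      congr 2
      ring
    rw [h2, h3]
    ring

end Recursion

end ModRep

theorem mainTheorem5 {F : Type*} [Field F] [Fintype F] (p g : ℕ) [Fact p.Prime] [CharP F p]
    (hg : 1 ≤ g) (hF : Fintype.card F = p ^ g) (k : ℤ) :
    ModRep.M F k =
      ModRep.M F (k - p) * ModRep.cls (FDRep.of (ModRep.frobTwist p 1 (ModRep.symRep F 1))) -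
        (ModRep.detUnit F : ModRep.K0 F (ModRep.GL2 F)) ^ p * ModRep.M F (k - 2 * p) :=
  ModRep.M_recursion F p k
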